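/- **Theorem (generic excess risk rate for the hinge loss).** Let $P$ be the law of a random pair $(\mathbf X,Y)$ with $\mathbf X\in[0,1]^d$ and $Y\in\{-1,1\}$, let $P_X$ be the law of $\mathbf X$ and $\eta(\mathbf x)=\Pr(Y=1\mid \mathbf X=\mathbf x)$. Let $\phi(z)=\max\{1-z,0\}$ be the hinge loss, $\mathcal E_\phi(f)=\mathrm E[\phi(Yf(\mathbf X))]$, let $f_\phi^*$ be a minimizer of $\mathcal E_\phi$ over all measurable functions $[0,1]^d\to\mathbb R$, and $C^*$ a minimizer of $\Pr(C(\mathbf X)\neq Y)$ over all measurable $C:[0,1]^d\to\{-1,1\}$. Put $\mathcal E_\phi(f,f_\phi^*)=\mathcal E_\phi(f)-\mathcal E_\phi(f_\phi^*)$ and $\mathcal E(f,C^*)=\Pr(Yf(\mathbf X)<0)-\Pr(YC^*(\mathbf X)<0)$. For real sequences, $u_n\lesssim v_n$ (equivalently $v_n\gtrsim u_n$) means that for some constant $C>0$, $u_n\le Cv_n$ for all sufficiently large $n$, and $u_n\asymp v_n$ means $u_n\lesssim v_n$ and $v_n\lesssim u_n$. Let $\mu$ be a Borel measure on $[0,1]^d$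 with $P_X\le\kappa\mu$ for some $\kappa<\infty$ (for instance $\mu=P_X$, or $\mu$ = Lebesgue measure if $P_X$ has a bounded density). A $\delta$-bracketing set of a class $\mathcal G$ is a finite family of pairs $(l_i,u_i)$ of measurable functions with $\|u_i-l_i\|_{L_2(\mu)}\le\delta$ such that every $f\in\mathcal G$ satisfies $l_i\le f\le u_i$ pointwise for some $i$; $H_B(\delta,\mathcal G,\|\cdot\|_2)$ is the logarithm of the least cardinality of a $\delta$-bracketing set ($\infty$ if there is none). Let $q\in[0,\infty]$, with the conventions $\nu=q/(q+1)=1$ and $(q+2)/(q+1)=1$ for $q=\infty$. Let $\mathcal F_n$ ($n\ge1$) be classes of measurable functions $[0,1]^d\to\mathbb R$, and $(a_n),(F_n),(\delta_n)$ sequences of positive reals, such that: * (N) there is $C>0$ with $P_X(\{\mathbf x:|2\eta(\mathbf x)-1|\le t\})\le Ct^q$ for all $t>0$ (for $q=\infty$: there is $t>0$ with $P_X(\{\mathbf x:|2\eta(\mathbf x)-1|\le t\})=0$); * (A2) $a_n=O(n^{-a_0})$ for some $a_0>0$, and for every $n\ge1$ there is $f_n\in\mathcal F_n$ with $\mathcal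 E_\phi(f_n,f_\phi^*)\le a_n$; * (A3) $F_n\gtrsim1$ and $\sup_{f\in\mathcal F_n}\|f\|_\infty\le F_n$ for every $n\ge1$; * (A5) there is $C_3>0$ with $H_B(\delta_n,\mathcal F_n,\|\cdot\|_2)\le C_3\,n\,(\delta_n/F_n)^{2-\nu}$ for every $n\ge1$. Let $\epsilon_n^2\asymp\max\{a_n,\delta_n\}$ and suppose that $n^{1-\iota}(\epsilon_n^2/F_n)^{(q+2)/(q+1)}\gtrsim1$ for some $\iota>0$. Let $(\mathbf x_i,y_i)$, $i=1,\dots,n$, be independent with law $P$, and let $\widehat f_{\phi,n}$ be a function of the sample that almost surely minimizes $\frac1n\sum_{i=1}^n\phi(y_if(\mathbf x_i))$ over $f\in\mathcal F_n$, such that $\mathcal E(\widehat f_{\phi,n},C^*)$ is a measurable function of the sample up to null sets. Then $$\mathrm E\big[\mathcal E(\widehat f_{\phi,n},C^*)\big]\lesssim\epsilon_n^2,$$ where the expectation is over the training sample. -/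

import Mathlib

open MeasureTheory ProbabilityTheory Filter Topology
open scoped ENNReal NNReal

namespace HingeRate

noncomputable section

/-- `a ≲ b` for real sequences: there is `C > 0` with `a n ≤ C * b n` for all large `n`. -/
def Lesssim (a b : ℕ → ℝ) : Prop :=
  ∃ C : ℝ, 0 < C ∧ ∀ᶠ n in atTop, a n ≤ C * b n

/-- `a ≍ b` for real sequences. -/
def Asymp (a b : ℕ → ℝ) : Prop := Lesssim a b ∧ Lesssim b a

/-- The input space `[0,1]^d`. -/
abbrev Cube (d : ℕ) : Type := ↥(Set.Icc (0 : Fin d → ℝ) 1)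

/-- The hinge loss. -/
def hinge (z : ℝ) : ℝ := max (1 - z) 0

section Risk

variable {X : Type*} [MeasurableSpace X]

/-- The 0-1 risk `E[1(Y f(X) < 0)]`. -/
def risk01 (P : Measure (X × ℝ)) (f : X → ℝ) : ℝ := P.real {z | z.2 * f z.1 < 0}

/-- The excess (0-1) risk of `f` relative to the classifier `C`. -/
def excessRisk01 (P : Measure (X × ℝ)) (f C : X → ℝ) : ℝ := risk01 P f - risk01 P C

/-- The `φ`-risk `E[φ(Y f(X))]` of a nonnegative loss, with values in `[0, ∞]`, so that it is
meaningful for every measurable `f`. -/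
def phiRisk (φ : ℝ → ℝ) (P : Measure (X × ℝ)) (f : X → ℝ) : ℝ≥0∞ :=
  ∫⁻ z, ENNReal.ofReal (φ (z.2 * f z.1)) ∂P

/-- The excess `φ`-risk of `f` relative to `g` (used only where both `φ`-risks are finite). -/
def excessPhiRisk (φ : ℝ → ℝ) (P : Measure (X × ℝ)) (f g : X → ℝ) : ℝ :=
  (phiRisk φ P f).toReal - (phiRisk φ P g).toReal

/-- A classifier: a measurable function with values in `{-1, 1}`. -/
def IsClassifier (C : X → ℝ) : Prop := Measurable C ∧ ∀ x, C x = 1 ∨ C x = -1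

/-- `C` is a Bayes classifier: it minimizes `Pr(C(X) ≠ Y)` over all classifiers. -/
def IsBayesClassifier (P : Measure (X × ℝ)) (C : X → ℝ) : Prop :=
  IsClassifier C ∧ ∀ C' : X → ℝ, IsClassifier C' → P {z | C z.1 ≠ z.2} ≤ P {z | C' z.1 ≠ z.2}

/-- `f` minimizes the `φ`-risk over all measurable functions. -/
def IsPhiRiskMinimizer (φ : ℝ → ℝ) (P : Measure (X × ℝ)) (f : X → ℝ) : Prop :=
  Measurable f ∧ ∀ g : X → ℝ, Measurable g → phiRisk φ P f ≤ phiRisk φ P g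

/-- The empirical `φ`-risk of `f` on the sample `S`. -/
def empiricalPhiRisk (φ : ℝ → ℝ) {n : ℕ} (S : Fin n → X × ℝ) (f : X → ℝ) : ℝ :=
  (∑ i, φ ((S i).2 * f (S i).1)) / n

/-- `f` minimizes the empirical `φ`-risk over the class `G`. -/
def IsEmpiricalMinimizer (φ : ℝ → ℝ) {n : ℕ} (S : Fin n → X × ℝ) (G : Set (X → ℝ))
    (f : X → ℝ) : Prop :=
  f ∈ G ∧ ∀ g ∈ G, empiricalPhiRisk φ S f ≤ empiricalPhiRisk φ S g

/-- The conditional class probability `η(x) = Pr(Y = 1 | X = x)`. -/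
def eta (P : Measure (X × ℝ)) [IsFiniteMeasure P] (x : X) : ℝ := (P.condKernel x).real {1}

/-- The Tsybakov noise condition with exponent `q ∈ [0, ∞]`. For `q = ∞` it says, as usual, that
`|2η(X) - 1|` is almost surely bounded away from zero. -/
def NoiseCondition (P : Measure (X × ℝ)) [IsFiniteMeasure P] (q : ℝ≥0∞) : Prop :=
  if q = ⊤ then ∃ t : ℝ, 0 < t ∧ P.fst {x | |2 * eta P x - 1| ≤ t} = 0
  else ∃ C : ℝ, 0 < C ∧ ∀ t : ℝ, 0 < t →
    P.fst.real {x | |2 * eta P x - 1| ≤ t} ≤ C * t ^ q.toReal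

/-- The pairs `(l i, u i)`, `i < N`, form a `δ`-bracketing set of `G` in `L^p(μ)`. -/
def IsBracketing (μ : Measure X) (p : ℝ≥0∞) (δ : ℝ) (G : Set (X → ℝ)) (N : ℕ)
    (l u : Fin N → X → ℝ) : Prop :=
  (∀ i, Measurable (l i) ∧ Measurable (u i) ∧
    eLpNorm (fun x => u i x - l i x) p μ ≤ ENNReal.ofReal δ) ∧
  ∀ f ∈ G, ∃ i, ∀ x, l i x ≤ f x ∧ f x ≤ u i x

/-- The `δ`-bracketing number, equal to `∞` if there is no finite `δ`-bracketing set. -/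
def bracketingNumber (μ : Measure X) (p : ℝ≥0∞) (δ : ℝ) (G : Set (X → ℝ)) : ℕ∞ :=
  ⨅ (N : ℕ) (_ : ∃ l u : Fin N → X → ℝ, IsBracketing μ p δ G N l u), (N : ℕ∞)

/-- The `δ`-bracketing entropy, the logarithm of the bracketing number (with `log ∞ = ∞`). -/
def bracketingEntropy (μ : Measure X) (p : ℝ≥0∞) (δ : ℝ) (G : Set (X → ℝ)) : EReal :=
  ENNReal.log ((bracketingNumber μ p δ G : ℕ∞) : ℝ≥0∞)

/-- Condition (A2): approximation of the `φ`-risk minimizer `fstar` by the classes `𝓕 n`. -/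
def ConditionA2 (φ : ℝ → ℝ) (P : Measure (X × ℝ)) (fstar : X → ℝ) (𝓕 : ℕ → Set (X → ℝ))
    (a : ℕ → ℝ) : Prop :=
  (∀ n, 1 ≤ n → 0 < a n) ∧
  (∃ a₀ : ℝ, 0 < a₀ ∧ Asymptotics.IsBigO atTop a (fun n : ℕ => (n : ℝ) ^ (-a₀))) ∧
  ∀ n, 1 ≤ n → ∃ f ∈ 𝓕 n, excessPhiRisk φ P f fstar ≤ a n

/-- Condition (A3): `F n ≳ 1` bounds the functions in `𝓕 n` uniformly. -/
def ConditionA3 (𝓕 : ℕ → Set (X → ℝ)) (F : ℕ → ℝ) : Prop :=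
  (∀ n, 1 ≤ n → 0 < F n) ∧ Lesssim (fun _ => 1) F ∧
  ∀ n, 1 ≤ n → ∀ f ∈ 𝓕 n, ∀ x, |f x| ≤ F n

/-- Condition (A5): the bracketing entropy bound, in `L^2(μ)` and with exponent `2 - ν`. -/
def ConditionA5 (μ : Measure X) (𝓕 : ℕ → Set (X → ℝ)) (F δ : ℕ → ℝ) (ν : ℝ) : Prop :=
  (∀ n, 1 ≤ n → 0 < δ n) ∧
  ∃ C₃ : ℝ, 0 < C₃ ∧ ∀ n : ℕ, 1 ≤ n →
    bracketingEntropy μ 2 (δ n) (𝓕 n) ≤ ((C₃ * n * (δ n / F n) ^ (2 - ν) : ℝ) : EReal)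

end Risk

/-- `ν = q / (q + 1)`, equal to `1` for `q = ∞`. -/
def nuExponent (q : ℝ≥0∞) : ℝ := if q = ⊤ then 1 else q.toReal / (q.toReal + 1)

/-- `(q + 2) / (q + 1)`, equal to `1` for `q = ∞`. -/
def rateExponent (q : ℝ≥0∞) : ℝ := if q = ⊤ then 1 else (q.toReal + 2) / (q.toReal + 1)

end

end HingeRate

/-!
A one-scale bracketing argument with localization. Write `f₀ = sign (2η - 1)` for the Bayes rule
and `e(f)` for the mean of `excessLoss P f`, the difference of the hinge losses of `f` and `f₀`.
Since `f₀` minimizes the hinge risk, `e(f)` is the excess hinge risk of `f`; unlike an arbitrary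
minimizer, `f₀` is bounded.

Three facts hold conditionally on `X = x`, where the loss has two values weighted by `η(x)` and
`1 - η(x)`, and are integrated by `integral_nonneg_of_eta`. First, the conditional excess hinge
risk is nonnegative. Second, the excess 0-1 risk is at most `e(f)`
(`excessRisk01_le_integral_excessLoss`), so it suffices to bound `e` at the empirical minimizer.
Third, for `|f| ≤ b`, the second moment of the excess loss is at most
`(5 b + 2 / t) e(f) + 4 Pr(|2η - 1| ≤ t)` for every `t > 0`. With the noise condition and the best
`t` this becomes `A b ^ (2 - ν) e(f) ^ ν` (`exists_integral_excessLoss_sq_le`).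

With this variance, Bernstein's inequality at a deviation of order `e` has the exponent
`n (e / b) ^ (2 - ν)` (`measureReal_sum_le_le_exp_rpow`). It is applied to the least excess loss
over each bracket that contains a function of excess risk at least `e`, and to a function
of the class whose excess risk is at most `a n`. If `e` dominates `a n` and `δ n`, then, outside an
event of probability `(N + 1) exp (- c n (e / b) ^ (2 - ν))`, where `N` is the number of brackets,
no function of excess risk at least `e` is an empirical minimizer (`exists_event_of_brackets`).

For `e = K ε n ^ 2` with `K` large, the entropy `log N` is at most half of that exponent, and the
growth condition makes the exponent at least a multiple of `n ^ ι`, while `ε n ^ 2` is at least a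
multiple of `1 / n`. As the excess 0-1 risk never exceeds `1`, the exceptional event contributes
less than a multiple of `ε n ^ 2` to the expectation.
-/

namespace HingeRate

noncomputable section

/-! ### Integrating out the label -/

section Conditional

variable {X : Type*} [MeasurableSpace X]

theorem eta_nonneg (P : Measure (X × ℝ)) [IsFiniteMeasure P] (x : X) : 0 ≤ eta P x :=
  measureReal_nonneg

theorem eta_le_one (P : Measure (X × ℝ)) [IsFiniteMeasure P] (x : X) : eta P x ≤ 1 :=
  measureReal_le_one

theorem measurable_eta (P : Measure (X × ℝ)) [IsFiniteMeasure P] : Measurable (eta P) :=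
  (Kernel.measurable_coe P.condKernel (measurableSet_singleton (1 : ℝ))).ennreal_toReal

/-- If the label is `±1` almost surely, an integral over `(X, Y)` is nonnegative as soon as the
conditional expectation given `X = x`, an `η`-weighted mean of the values at the two labels, is. -/
theorem integral_nonneg_of_eta {P : Measure (X × ℝ)} [IsProbabilityMeasure P]
    (hY : ∀ᵐ z ∂P, z.2 = 1 ∨ z.2 = -1) {g : X × ℝ → ℝ}
    (h : ∀ x, 0 ≤ eta P x * g (x, 1) + (1 - eta P x) * g (x, -1)) : 0 ≤ ∫ z, g z ∂P := by
  by_cases hg : Integrable g P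
  swap
  · rw [integral_undef hg]
  have hd : P.fst ⊗ₘ P.condKernel = P := P.disintegrate P.condKernel
  rw [← hd, Measure.integral_compProd (hd.symm ▸ hg)]
  refine integral_nonneg_of_ae ?_
  have hY' : ∀ᵐ x ∂P.fst, ∀ᵐ y ∂P.condKernel x, y = 1 ∨ y = -1 := by
    rw [← hd] at hY
    exact Measure.ae_ae_of_ae_compProd hY
  filter_upwards [hY'] with x hx
  have hset : ∀ᵐ y ∂P.condKernel x, y ∈ ({1, -1} : Finset ℝ) := by
    filter_upwards [hx] with y hy
    simpa using hy
  have hne : (1 : ℝ) ≠ -1 := by norm_num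
  have hrestr : (P.condKernel x).restrict (({1, -1} : Finset ℝ) : Set ℝ) = P.condKernel x :=
    Measure.restrict_eq_self_of_ae_mem hset
  have hone : (P.condKernel x).real {1} + (P.condKernel x).real {-1} = 1 := by
    rw [← measureReal_union (by simp [hne]) (measurableSet_singleton _)]
    have : (P.condKernel x) ({1} ∪ {-1}) = 1 := by
      rw [← prob_compl_eq_zero_iff (by measurability)]
      rw [ae_iff] at hx
      convert hx using 2
      ext y
      simp only [Set.mem_compl_iff, Set.mem_union, Set.mem_singleton_iff, Set.mem_ofPred_eq]
    rw [Measure.real, this, ENNReal.toReal_one]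
  have hint : ∫ y, g (x, y) ∂P.condKernel x
      = eta P x * g (x, 1) + (1 - eta P x) * g (x, -1) := by
    rw [← hrestr, setIntegral_finset _ (by
      exact IntegrableOn.finset)]
    rw [Finset.sum_pair hne]
    have h2 : 1 - eta P x = (P.condKernel x).real {-1} := by
      unfold eta; linarith
    rw [h2]
    simp [eta, smul_eq_mul]
  simp only [Pi.zero_apply]
  rw [hint]
  exact h x

end Conditional

/-! ### The hinge loss given the input -/

theorem hinge_nonneg (z : ℝ) : 0 ≤ hinge z := le_max_right _ _

theorem hinge_of_le {z : ℝ} (h : z ≤ 1) : hinge z = 1 - z := max_eq_left (by linarith)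

theorem hinge_of_ge {z : ℝ} (h : 1 ≤ z) : hinge z = 0 := max_eq_right (by linarith)

theorem hinge_antitone : Antitone hinge := fun _ _ h => max_le_max_right _ (by linarith)

theorem measurable_hinge : Measurable hinge := by unfold hinge; fun_prop

theorem abs_hinge_sub_le (a b : ℝ) : |hinge a - hinge b| ≤ |a - b| := by
  refine (abs_max_sub_max_le_abs _ _ _).trans (le_of_eq ?_)
  rw [abs_sub_comm a b]
  congr 1; ring

/-- Conditionally on `η(x) = p ≥ 1/2`, where the Bayes rule is `1`, the mean of the hinge loss
difference between `v` and `1`. -/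
def condExcess (p v : ℝ) : ℝ := p * (hinge v - hinge 1) + (1 - p) * (hinge (-v) - hinge (-1))

/-- The conditional second moment matching `condExcess`. -/
def condSecondMoment (p v : ℝ) : ℝ :=
  p * (hinge v - hinge 1) ^ 2 + (1 - p) * (hinge (-v) - hinge (-1)) ^ 2

/-- Conditional form of the variance bound. For `|v| ≤ 1` excess and second moment are
`(2p - 1)(1 - v)` and `(1 - v)²`; the part of `v` beyond `[-1, 1]` costs a factor of order `b`,
without any help from the noise condition. -/
theorem condSecondMoment_le {p v b : ℝ} (hp : 1 / 2 ≤ p) (hp1 : p ≤ 1) (hb : 1 ≤ b)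
    (hv : |v| ≤ b) :
    0 ≤ condExcess p v ∧ condSecondMoment p v ≤ 5 * b * condExcess p v + 4 ∧
      (2 * p - 1) * condSecondMoment p v ≤ (5 * b * (2 * p - 1) + 2) * condExcess p v := by
  obtain ⟨hv1, hv2⟩ := abs_le.1 hv
  have h1 : hinge 1 = 0 := hinge_of_ge le_rfl
  have h2 : hinge (-1) = 2 := by rw [hinge_of_le (by norm_num)]; norm_num
  unfold condExcess condSecondMoment
  rw [h1, h2]
  have hq : 0 ≤ 1 - p := by linarith
  have hm : 0 ≤ 2 * p - 1 := by linarith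
  rcases le_total 1 v with h | h
  · rw [hinge_of_ge h, hinge_of_le (by linarith)]
    have e0 : 0 ≤ (1 - p) * (v - 1) := mul_nonneg hq (by linarith)
    have e1 : (1 - p) * (v - 1) * (v - 1) ≤ (1 - p) * (v - 1) * (5 * b) :=
      mul_le_mul_of_nonneg_left (by linarith) e0
    refine ⟨by linarith, by linarith, ?_⟩
    have e2 := mul_le_mul_of_nonneg_left e1 hm
    linarith
  rcases le_total (-1) v with h' | h'
  · rw [hinge_of_le h, hinge_of_le (by linarith)]
    have e0 : 0 ≤ (2 * p - 1) * (1 - v) := mul_nonneg hm (by linarith)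
    have e1 : 0 ≤ b * ((2 * p - 1) * (1 - v)) := mul_nonneg (by linarith) e0
    have e2 : (2 * p - 1) * (1 - v) * (1 - v) ≤ (2 * p - 1) * (1 - v) * 2 :=
      mul_le_mul_of_nonneg_left (by linarith) e0
    have e3 : 0 ≤ (2 * p - 1) * (b * ((2 * p - 1) * (1 - v))) := mul_nonneg hm e1
    refine ⟨by linarith, by nlinarith, by linarith⟩
  · rw [hinge_of_le h, hinge_of_ge (by linarith : 1 ≤ -v)]
    -- `w` is the excess of `-v` over `1`
    obtain ⟨w, rfl⟩ : ∃ w, v = -1 - w := ⟨-1 - v, by ring⟩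
    have hw : 0 ≤ w := by linarith
    have e0 : 0 ≤ p * w := mul_nonneg (by linarith) hw
    have e1 : p * w * (4 + w) ≤ p * w * (5 * b) := mul_le_mul_of_nonneg_left (by linarith) e0
    have e2 := mul_le_mul_of_nonneg_left e1 hm
    have e3 : 0 ≤ b * (2 * p - 1) := mul_nonneg (by linarith) hm
    have e4 : 0 ≤ b * (2 * p - 1) * (2 * p - 1) := mul_nonneg e3 hm
    refine ⟨by linarith, by linarith, by linarith⟩

/-- Conditional form of the comparison of the excess 0-1 risk with the excess hinge risk. -/
theorem ite_sub_ite_le_condExcess {p v c : ℝ} (hp : 1 / 2 ≤ p) (hp1 : p ≤ 1)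
    (hc : c = 1 ∨ c = -1) :
    (p * (if v < 0 then 1 else 0) + (1 - p) * (if -v < 0 then 1 else 0)) -
      (p * (if c < 0 then 1 else 0) + (1 - p) * (if -c < 0 then 1 else 0)) ≤ condExcess p v := by
  have hex := (condSecondMoment_le hp hp1 (le_max_right |v| 1) (le_max_left |v| 1)).1
  have hcmin : 1 - p ≤ p * (if c < 0 then 1 else 0) + (1 - p) * (if -c < 0 then 1 else 0) := by
    rcases hc with rfl | rfl <;> norm_num
    linarith
  rcases lt_or_ge v 0 with hv | hv
  · have h1 : hinge 1 = 0 := hinge_of_ge le_rfl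
    have h2 : hinge (-1) = 2 := by rw [hinge_of_le (by norm_num)]; norm_num
    have h3 : 1 - v = hinge v := (hinge_of_le (by linarith)).symm
    have h4 : 1 + v ≤ hinge (-v) := by unfold hinge; exact le_max_of_le_left (by linarith)
    have h5 : 2 * p - 1 ≤ condExcess p v := by
      unfold condExcess
      rw [h1, h2, ← h3]
      nlinarith
    rw [if_pos hv, if_neg (by linarith : ¬ -v < 0)]
    linarith
  · rw [if_neg (not_lt.2 hv)]
    have : (1 - p) * (if -v < 0 then 1 else 0) ≤ 1 - p := by
      split_ifs <;> linarith
    linarith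

/-! ### The excess hinge risk -/

section Excess

variable {X : Type*} [MeasurableSpace X]

/-- The classifier `sign (2η - 1)`, with the value `1` where `η = 1/2`. It minimizes the hinge risk
over all measurable functions and, unlike an arbitrary minimizer, it is bounded. -/
def bayesRule (P : Measure (X × ℝ)) [IsFiniteMeasure P] (x : X) : ℝ :=
  if 1 / 2 ≤ eta P x then 1 else -1

/-- The difference between the hinge losses of `f` and of the Bayes rule at the labelled point
`z = (x, y)`. Its mean is the excess hinge risk of `f`. -/
def excessLoss (P : Measure (X × ℝ)) [IsFiniteMeasure P] (f : X → ℝ) (z : X × ℝ) : ℝ :=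
  hinge (z.2 * f z.1) - hinge (z.2 * bayesRule P z.1)

theorem measurable_bayesRule (P : Measure (X × ℝ)) [IsFiniteMeasure P] :
    Measurable (bayesRule P) :=
  Measurable.ite (measurableSet_le measurable_const (measurable_eta P)) measurable_const
    measurable_const

theorem abs_bayesRule (P : Measure (X × ℝ)) [IsFiniteMeasure P] (x : X) : |bayesRule P x| = 1 := by
  unfold bayesRule; split_ifs <;> simp

theorem measurable_excessLoss (P : Measure (X × ℝ)) [IsFiniteMeasure P] {f : X → ℝ}
    (hf : Measurable f) : Measurable (excessLoss P f) := by
  have := measurable_bayesRule P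
  have := measurable_hinge
  unfold excessLoss
  fun_prop

theorem abs_label_mul {y v : ℝ} (hy : y = 1 ∨ y = -1) : |y * v| = |v| := by
  rcases hy with rfl | rfl <;> simp

theorem abs_excessLoss_le (P : Measure (X × ℝ)) [IsFiniteMeasure P] {f : X → ℝ} {z : X × ℝ}
    (hz : z.2 = 1 ∨ z.2 = -1) {b : ℝ} (hb : 1 ≤ b) (hf : |f z.1| ≤ b) :
    |excessLoss P f z| ≤ 2 * b := by
  refine (abs_hinge_sub_le _ _).trans ?_
  rw [← mul_sub, abs_label_mul hz]
  refine (abs_sub _ _).trans ?_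
  rw [abs_bayesRule]
  linarith

section

variable {P : Measure (X × ℝ)} [IsProbabilityMeasure P]

theorem ae_abs_excessLoss_le (hY : ∀ᵐ z ∂P, z.2 = 1 ∨ z.2 = -1) {f : X → ℝ} {b : ℝ} (hb : 1 ≤ b)
    (hf : ∀ x, |f x| ≤ b) : ∀ᵐ z ∂P, |excessLoss P f z| ≤ 2 * b := by
  filter_upwards [hY] with z hz using abs_excessLoss_le P hz hb (hf _)

theorem integrable_excessLoss (hY : ∀ᵐ z ∂P, z.2 = 1 ∨ z.2 = -1) {f : X → ℝ} (hfm : Measurable f)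
    {b : ℝ} (hb : 1 ≤ b) (hf : ∀ x, |f x| ≤ b) : Integrable (excessLoss P f) P :=
  Integrable.of_bound (measurable_excessLoss P hfm).aestronglyMeasurable (2 * b)
    (ae_abs_excessLoss_le hY hb hf)

theorem integrable_excessLoss_sq (hY : ∀ᵐ z ∂P, z.2 = 1 ∨ z.2 = -1) {f : X → ℝ}
    (hfm : Measurable f) {b : ℝ} (hb : 1 ≤ b) (hf : ∀ x, |f x| ≤ b) :
    Integrable (fun z => excessLoss P f z ^ 2) P := by
  refine Integrable.of_bound ((measurable_excessLoss P hfm).pow_const 2).aestronglyMeasurable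
    ((2 * b) ^ 2) ?_
  filter_upwards [ae_abs_excessLoss_le hY hb hf] with z hz
  rw [Real.norm_eq_abs, abs_pow]
  gcongr

theorem integral_excessLoss_le (hY : ∀ᵐ z ∂P, z.2 = 1 ∨ z.2 = -1) {f : X → ℝ}
    (hfm : Measurable f) {b : ℝ} (hb : 1 ≤ b) (hf : ∀ x, |f x| ≤ b) :
    ∫ z, excessLoss P f z ∂P ≤ 2 * b := by
  calc ∫ z, excessLoss P f z ∂P ≤ ∫ _, 2 * b ∂P := by
        refine integral_mono_ae (integrable_excessLoss hY hfm hb hf) (integrable_const _) ?_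
        filter_upwards [ae_abs_excessLoss_le hY hb hf] with z hz using (le_abs_self _).trans hz
    _ = 2 * b := by simp

theorem etaMean_excessLoss_bounds {f : X → ℝ} {b : ℝ} (hb : 1 ≤ b) (hf : ∀ x, |f x| ≤ b) (x : X) :
    let e := eta P x * excessLoss P f (x, 1) + (1 - eta P x) * excessLoss P f (x, -1)
    let v := eta P x * excessLoss P f (x, 1) ^ 2 + (1 - eta P x) * excessLoss P f (x, -1) ^ 2
    0 ≤ e ∧ v ≤ 5 * b * e + 4 ∧
      |2 * eta P x - 1| * v ≤ (5 * b * |2 * eta P x - 1| + 2) * e := by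
  intro e v
  rcases le_or_gt (1 / 2) (eta P x) with h | h
  · have := condSecondMoment_le h (eta_le_one P x) hb (hf x)
    rw [abs_of_nonneg (by linarith)]
    have hs : bayesRule P x = 1 := if_pos h
    simpa [e, v, condExcess, condSecondMoment, excessLoss, hs] using this
  · have := condSecondMoment_le (p := 1 - eta P x) (by linarith)
      (by linarith [eta_nonneg P x]) hb ((abs_neg (f x)).trans_le (hf x))
    have he : e = condExcess (1 - eta P x) (-f x) := by
      simp only [e, condExcess, excessLoss, bayesRule, not_le.2 h, if_false]
      ring_nf
    have hv : v = condSecondMoment (1 - eta P x) (-f x) := by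
      simp only [v, condSecondMoment, excessLoss, bayesRule, not_le.2 h, if_false]
      ring_nf
    rw [abs_of_neg (by linarith), he, hv]
    convert! this using 4 <;> ring

/-- The second moment of the excess loss, after splitting at the level `t` of `|2η - 1|`. -/
theorem integral_excessLoss_sq_le (hY : ∀ᵐ z ∂P, z.2 = 1 ∨ z.2 = -1) {f : X → ℝ}
    (hfm : Measurable f) {b : ℝ} (hb : 1 ≤ b) (hf : ∀ x, |f x| ≤ b) {t : ℝ} (ht : 0 < t) :
    ∫ z, excessLoss P f z ^ 2 ∂P ≤ (5 * b + 2 / t) * ∫ z, excessLoss P f z ∂P +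
      4 * P.fst.real {x | |2 * eta P x - 1| ≤ t} := by
  set T : Set X := {x | |2 * eta P x - 1| ≤ t} with hT
  have hTm : MeasurableSet T := by
    have := measurable_eta P
    exact measurableSet_le (by fun_prop) measurable_const
  have hTm' : MeasurableSet (Prod.fst ⁻¹' T : Set (X × ℝ)) := measurable_fst hTm
  have hi1 := (integrable_excessLoss hY hfm hb hf).const_mul (5 * b + 2 / t)
  have hi2 := integrable_excessLoss_sq hY hfm hb hf
  set I : X × ℝ → ℝ := (Prod.fst ⁻¹' T : Set (X × ℝ)).indicator 1 with hI
  have hi3 : Integrable (fun z => 4 * I z) P :=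
    ((integrable_const (1 : ℝ)).indicator hTm').const_mul 4
  have hi4 : Integrable (fun z => (5 * b + 2 / t) * excessLoss P f z + 4 * I z) P := hi1.add hi3
  have key : 0 ≤ ∫ z, ((5 * b + 2 / t) * excessLoss P f z +
      4 * I z - excessLoss P f z ^ 2) ∂P := by
    refine integral_nonneg_of_eta hY fun x => ?_
    obtain ⟨h1, h2, h3⟩ := etaMean_excessLoss_bounds (P := P) hb hf x
    set e := eta P x * excessLoss P f (x, 1) + (1 - eta P x) * excessLoss P f (x, -1) with he
    set v := eta P x * excessLoss P f (x, 1) ^ 2 + (1 - eta P x) * excessLoss P f (x, -1) ^ 2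
      with hv
    set m := |2 * eta P x - 1| with hm
    have hte : 0 ≤ 2 / t * e := by positivity
    by_cases hx : m ≤ t
    · have hx1 : ∀ y : ℝ, I (x, y) = 1 := fun y =>
        Set.indicator_of_mem (show (x, y) ∈ (Prod.fst ⁻¹' T : Set (X × ℝ)) from hx) _
      rw [hx1, hx1]
      linarith
    · have hx0 : ∀ y : ℝ, I (x, y) = 0 := fun y =>
        Set.indicator_of_notMem (show (x, y) ∉ (Prod.fst ⁻¹' T : Set (X × ℝ)) from hx) _
      rw [hx0, hx0]
      push Not at hx
      have hm0 : 0 < m := ht.trans hx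
      have h4 : v ≤ (5 * b + 2 / m) * e := by
        have h5 : (5 * b + 2 / m) * e = ((5 * b * m + 2) * e) / m := by field_simp
        rw [h5, le_div_iff₀ hm0]
        linarith
      have h6 : 2 / m * e ≤ 2 / t * e := by gcongr
      linarith
  rw [integral_sub hi4 hi2, integral_add hi1 hi3, integral_const_mul,
    integral_const_mul, integral_indicator_one hTm'] at key
  have hfst : P.real (Prod.fst ⁻¹' T) = P.fst.real T := by
    rw [Measure.real, Measure.real, Measure.fst_apply hTm]
  rw [hfst] at key
  linarith

/-- The excess 0-1 risk, relative to any classifier, is at most the excess hinge risk. -/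
theorem excessRisk01_le_integral_excessLoss (hY : ∀ᵐ z ∂P, z.2 = 1 ∨ z.2 = -1) {f C : X → ℝ}
    (hfm : Measurable f) {b : ℝ} (hb : 1 ≤ b) (hf : ∀ x, |f x| ≤ b) (hC : IsClassifier C) :
    excessRisk01 P f C ≤ ∫ z, excessLoss P f z ∂P := by
  have hm : ∀ {g : X → ℝ}, Measurable g → MeasurableSet {z : X × ℝ | z.2 * g z.1 < 0} :=
    fun hg => measurableSet_lt (by fun_prop) measurable_const
  have hr : ∀ {g : X → ℝ}, Measurable g →
      risk01 P g = ∫ z, {z : X × ℝ | z.2 * g z.1 < 0}.indicator 1 z ∂P :=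
    fun hg => (integral_indicator_one (hm hg)).symm
  have hi : ∀ {g : X → ℝ}, Measurable g →
      Integrable ({z : X × ℝ | z.2 * g z.1 < 0}.indicator (1 : X × ℝ → ℝ)) P :=
    fun hg => (integrable_const (1 : ℝ)).indicator (hm hg)
  rw [excessRisk01, hr hfm, hr hC.1, ← sub_nonneg, ← integral_sub (hi hfm) (hi hC.1),
    ← integral_sub (integrable_excessLoss hY hfm hb hf)
      (show Integrable (fun z => {z : X × ℝ | z.2 * f z.1 < 0}.indicator (1 : X × ℝ → ℝ) z -
        {z : X × ℝ | z.2 * C z.1 < 0}.indicator (1 : X × ℝ → ℝ) z) P from (hi hfm).sub (hi hC.1))]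
  refine integral_nonneg_of_eta hY fun x => ?_
  simp only [Set.indicator_apply, Set.mem_ofPred_eq, Pi.one_apply, one_mul, neg_one_mul]
  rcases le_or_gt (1 / 2) (eta P x) with h | h
  · have := ite_sub_ite_le_condExcess (v := f x) h (eta_le_one P x) (hC.2 x)
    simp only [condExcess] at this
    simp only [excessLoss, bayesRule, h, if_true, one_mul, neg_one_mul]
    linarith
  · have hC' : -C x = 1 ∨ -C x = -1 := by
      rcases hC.2 x with h | h <;> simp [h]
    have := ite_sub_ite_le_condExcess (p := 1 - eta P x) (v := -f x) (by linarith)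
      (by linarith [eta_nonneg P x]) hC'
    simp only [condExcess, neg_neg] at this
    simp only [excessLoss, bayesRule, not_le.2 h, if_false, one_mul, neg_one_mul, neg_neg]
    linarith

theorem phiRisk_hinge_eq (hY : ∀ᵐ z ∂P, z.2 = 1 ∨ z.2 = -1) {f : X → ℝ}
    (hfm : Measurable f) {b : ℝ} (hf : ∀ x, |f x| ≤ b) :
    Integrable (fun z => hinge (z.2 * f z.1)) P ∧
      phiRisk hinge P f = ENNReal.ofReal (∫ z, hinge (z.2 * f z.1) ∂P) := by
  have hi : Integrable (fun z => hinge (z.2 * f z.1)) P := by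
    refine Integrable.of_bound (C := 1 + b)
      (measurable_hinge.comp (by fun_prop)).aestronglyMeasurable ?_
    filter_upwards [hY] with z hz
    rw [Real.norm_eq_abs, abs_of_nonneg (hinge_nonneg _)]
    have h1 := neg_abs_le (z.2 * f z.1)
    have h2 := hf z.1
    have h3 := abs_nonneg (f z.1)
    rw [abs_label_mul hz] at h1
    exact max_le (by linarith) (by linarith)
  exact ⟨hi, (ofReal_integral_eq_lintegral_ofReal hi (ae_of_all _ fun _ => hinge_nonneg _)).symm⟩

/-- Passing from an arbitrary minimizer of the hinge risk to the Bayes rule does not increase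
excess risks. -/
theorem integral_excessLoss_le_excessPhiRisk (hY : ∀ᵐ z ∂P, z.2 = 1 ∨ z.2 = -1) {f fstar : X → ℝ}
    (hfm : Measurable f) {b : ℝ} (hf : ∀ x, |f x| ≤ b) (hstar : IsPhiRiskMinimizer hinge P fstar) :
    ∫ z, excessLoss P f z ∂P ≤ excessPhiRisk hinge P f fstar := by
  obtain ⟨hi1, h1⟩ := phiRisk_hinge_eq hY hfm hf
  obtain ⟨hi2, h2⟩ := phiRisk_hinge_eq hY (measurable_bayesRule P)
    (fun x => (abs_bayesRule P x).le)
  have h3 := ENNReal.toReal_mono (by rw [h2]; exact ENNReal.ofReal_ne_top)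
    (hstar.2 _ (measurable_bayesRule P))
  rw [h2, ENNReal.toReal_ofReal (integral_nonneg fun _ => hinge_nonneg _)] at h3
  unfold excessPhiRisk excessLoss
  rw [integral_sub hi1 hi2, h1, ENNReal.toReal_ofReal (integral_nonneg fun _ => hinge_nonneg _)]
  linarith

end

end Excess

/-! ### The variance bound and a Bernstein-type inequality -/

theorem two_sub_nuExponent (q : ℝ≥0∞) : 2 - nuExponent q = rateExponent q := by
  unfold nuExponent rateExponent
  split_ifs
  · norm_num
  · have : q.toReal + 1 ≠ 0 := by positivity
    field_simp; ring

theorem one_le_rateExponent (q : ℝ≥0∞) : 1 ≤ rateExponent q := by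
  unfold rateExponent
  split_ifs
  · rfl
  · rw [le_div_iff₀ (by positivity)]; linarith

theorem rateExponent_le_two (q : ℝ≥0∞) : rateExponent q ≤ 2 := by
  unfold rateExponent
  split_ifs
  · norm_num
  · rw [div_le_iff₀ (by positivity)]
    linarith [q.toReal_nonneg]

theorem rpow_le_two_mul {x r : ℝ} (hx : 0 < x) (hx2 : x ≤ 2) (hr1 : 1 ≤ r) (hr2 : r ≤ 2) :
    x ^ r ≤ 2 * x := by
  have h1 : x ^ r = x ^ (r - 1) * x := by
    rw [← Real.rpow_add_one hx.ne']; ring_nf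
  have h2 : x ^ (r - 1) ≤ 2 := by
    calc x ^ (r - 1) ≤ 2 ^ (r - 1) := Real.rpow_le_rpow hx.le hx2 (by linarith)
      _ ≤ (2 : ℝ) ^ (1 : ℝ) := Real.rpow_le_rpow_of_exponent_le one_le_two (by linarith)
      _ = 2 := Real.rpow_one 2
  rw [h1]
  gcongr

section Variance

variable {X : Type*} [MeasurableSpace X] {P : Measure (X × ℝ)} [IsProbabilityMeasure P]

/-- The variance bound `E[excessLoss²] ≲ b ^ (2 - ν) * e ^ ν` given by the noise condition, for
functions bounded by `b` with excess hinge risk at most `e`. In this form, multiplied by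
`(e / b) ^ (2 - ν)`, no power has to be taken of an excess risk that may vanish. -/
theorem exists_integral_excessLoss_sq_le (hY : ∀ᵐ z ∂P, z.2 = 1 ∨ z.2 = -1) {q : ℝ≥0∞}
    (hN : NoiseCondition P q) :
    ∃ A : ℝ, 0 < A ∧ ∀ (b : ℝ), 1 ≤ b → ∀ f : X → ℝ, Measurable f → (∀ x, |f x| ≤ b) →
      ∀ e : ℝ, 0 < e → e ≤ 2 * b → ∫ z, excessLoss P f z ∂P ≤ e →
        (e / b) ^ rateExponent q * ∫ z, excessLoss P f z ^ 2 ∂P ≤ A * e ^ 2 := by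
  unfold NoiseCondition at hN
  split_ifs at hN with hq
  · obtain ⟨t, ht, h0⟩ := hN
    refine ⟨5 + 2 / t, by positivity, fun b hb f hfm hf e he he2 hfe => ?_⟩
    have h := integral_excessLoss_sq_le hY hfm hb hf ht
    rw [Measure.real, h0, ENNReal.toReal_zero, mul_zero, add_zero] at h
    have hb0 : 0 < b := by linarith
    rw [rateExponent, if_pos hq, Real.rpow_one]
    calc e / b * ∫ z, excessLoss P f z ^ 2 ∂P ≤ e / b * ((5 * b + 2 / t) * e) := by
          gcongr; exact h.trans (by gcongr)
      _ = 5 * e ^ 2 + 2 / t * e ^ 2 / b := by field_simp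
      _ ≤ 5 * e ^ 2 + 2 / t * e ^ 2 := by gcongr; exact div_le_self (by positivity) hb
      _ = _ := by ring
  · obtain ⟨C, hC, hN⟩ := hN
    refine ⟨12 + 4 * C, by positivity, fun b hb f hfm hf e he he2 hfe => ?_⟩
    have hb0 : 0 < b := by linarith
    set s := q.toReal with hs
    have hs0 : 0 ≤ s := ENNReal.toReal_nonneg
    have hs1 : s + 1 ≠ 0 := by positivity
    -- this level balances the two terms `e / t` and `t ^ q`
    set t := e ^ (1 / (s + 1)) with ht
    have ht0 : 0 < t := Real.rpow_pos_of_pos he _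
    have h := integral_excessLoss_sq_le hY hfm hb hf ht0
    have hr : rateExponent q = 1 + 1 / (s + 1) := by
      rw [rateExponent, if_neg hq]; field_simp; ring
    set ρ := (e / b) ^ rateExponent q with hρ
    have hρ0 : 0 < ρ := Real.rpow_pos_of_pos (by positivity) _
    have h1 : ρ * b ≤ 2 * e := by
      have := rpow_le_two_mul (x := e / b) (by positivity) ((div_le_iff₀ hb0).2 he2)
        (one_le_rateExponent q) (rateExponent_le_two q)
      calc ρ * b ≤ 2 * (e / b) * b := by gcongr
        _ = 2 * e := by field_simp
    have h2 : ρ ≤ e * t := by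
      calc ρ ≤ e ^ rateExponent q := by
            refine Real.rpow_le_rpow (by positivity) (div_le_self he.le hb) ?_
            linarith [one_le_rateExponent q]
        _ = e * t := by rw [hr, Real.rpow_add he, Real.rpow_one]
    have h3 : t * t ^ s = e := by
      rw [mul_comm, ← Real.rpow_add_one ht0.ne', ht, ← Real.rpow_mul he.le,
        one_div_mul_cancel hs1, Real.rpow_one]
    calc ρ * ∫ z, excessLoss P f z ^ 2 ∂P
        ≤ ρ * ((5 * b + 2 / t) * e + 4 * (C * t ^ s)) := by
          gcongr
          refine h.trans ?_
          gcongr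
          exact hN t ht0
      _ = 5 * (ρ * b) * e + 2 * ρ / t * e + 4 * C * (ρ * t ^ s) := by ring
      _ ≤ 5 * (2 * e) * e + 2 * (e * t) / t * e + 4 * C * (e * t * t ^ s) := by gcongr
      _ = (12 + 4 * C) * e ^ 2 := by
          rw [mul_assoc e t, h3]; field_simp; ring

end Variance

section Chernoff

/-- A Bernstein-type lower tail bound for a sum of independent copies of a bounded variable, before
optimization over the parameter `c`. -/
theorem measureReal_sum_le_le_exp {Ω : Type*} [MeasurableSpace Ω] {P : Measure Ω}
    [IsProbabilityMeasure P] {Z : Ω → ℝ} (hZ : Measurable Z) {B : ℝ} (hB : ∀ᵐ z ∂P, |Z z| ≤ B)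
    {c : ℝ} (hc : 0 ≤ c) (hcB : c * B ≤ 1) (n : ℕ) (s : ℝ) :
    (Measure.pi fun _ : Fin n => P).real {S | ∑ i, Z (S i) ≤ n * s} ≤
      Real.exp (n * (c * s - c * ∫ z, Z z ∂P + c ^ 2 * ∫ z, Z z ^ 2 ∂P)) := by
  have hcZ : ∀ᵐ z ∂P, |-(c * Z z)| ≤ 1 := by
    filter_upwards [hB] with z hz
    rw [abs_neg, abs_mul, abs_of_nonneg hc]
    exact (mul_le_mul_of_nonneg_left hz hc).trans hcB
  have hi1 : Integrable Z P := Integrable.of_bound hZ.aestronglyMeasurable B hB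
  have hi2 : Integrable (fun z => Z z ^ 2) P := by
    refine Integrable.of_bound (hZ.pow_const 2).aestronglyMeasurable (B ^ 2) ?_
    filter_upwards [hB] with z hz
    rw [Real.norm_eq_abs, abs_pow]
    gcongr
  have hGm : Measurable fun z => Real.exp (-(c * Z z)) := by fun_prop
  have hi3 : Integrable (fun z => Real.exp (-(c * Z z))) P := by
    refine Integrable.of_bound hGm.aestronglyMeasurable (Real.exp 1) ?_
    filter_upwards [hcZ] with z hz
    rw [Real.norm_eq_abs, Real.abs_exp]
    exact Real.exp_le_exp.2 (le_of_abs_le hz)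
  have hi4 : Integrable (fun z => 1 - c * Z z) P := (integrable_const 1).sub (hi1.const_mul c)
  have hmgf : ∫ z, Real.exp (-(c * Z z)) ∂P ≤
      Real.exp (-(c * ∫ z, Z z ∂P) + c ^ 2 * ∫ z, Z z ^ 2 ∂P) := by
    calc ∫ z, Real.exp (-(c * Z z)) ∂P ≤ ∫ z, (1 - c * Z z + c ^ 2 * Z z ^ 2) ∂P := by
          refine integral_mono_ae hi3 (hi4.add (hi2.const_mul (c ^ 2))) ?_
          filter_upwards [hcZ] with z hz
          have := le_of_abs_le (Real.abs_exp_sub_one_sub_id_le hz)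
          nlinarith
      _ = (-(c * ∫ z, Z z ∂P) + c ^ 2 * ∫ z, Z z ^ 2 ∂P) + 1 := by
          rw [integral_add hi4 (hi2.const_mul (c ^ 2)),
            integral_sub (integrable_const 1) (hi1.const_mul c), integral_const_mul,
            integral_const_mul, integral_const]
          simp only [probReal_univ, one_smul]
          ring
      _ ≤ _ := Real.add_one_le_exp _
  have hprod : ∫ S : Fin n → Ω, ∏ i, Real.exp (-(c * Z (S i))) ∂Measure.pi (fun _ => P) =
      (∫ z, Real.exp (-(c * Z z)) ∂P) ^ n := by
    have := integral_fintype_prod_eq_pow (ι := Fin n) (μ := P) (fun z => Real.exp (-(c * Z z)))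
    rwa [Fintype.card_fin] at this
  have hmarkov := mul_meas_ge_le_integral_of_nonneg (μ := Measure.pi fun _ : Fin n => P)
    (f := fun S => ∏ i, Real.exp (-(c * Z (S i))))
    (ae_of_all _ fun S => Finset.prod_nonneg fun i _ => (Real.exp_pos _).le)
    (Integrable.fintype_prod fun _ => hi3) (Real.exp (-(c * (n * s))))
  have hsub : (Measure.pi fun _ : Fin n => P).real {S | ∑ i, Z (S i) ≤ n * s} ≤
      (Measure.pi fun _ : Fin n => P).real
        {S | Real.exp (-(c * (n * s))) ≤ ∏ i, Real.exp (-(c * Z (S i)))} := by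
    refine measureReal_mono fun S hS => ?_
    simp only [Set.mem_ofPred_eq] at hS ⊢
    rw [← Real.exp_sum, Real.exp_le_exp, Finset.sum_neg_distrib, ← Finset.mul_sum]
    exact neg_le_neg (mul_le_mul_of_nonneg_left hS hc)
  rw [hprod] at hmarkov
  have hpow : (∫ z, Real.exp (-(c * Z z)) ∂P) ^ n ≤
      Real.exp (n * (-(c * ∫ z, Z z ∂P) + c ^ 2 * ∫ z, Z z ^ 2 ∂P)) := by
    rw [Real.exp_nat_mul]
    exact pow_le_pow_left₀ (integral_nonneg fun _ => (Real.exp_pos _).le) hmgf n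
  refine hsub.trans ?_
  have hexp : Real.exp (n * (c * s - c * ∫ z, Z z ∂P + c ^ 2 * ∫ z, Z z ^ 2 ∂P)) =
      Real.exp (n * (-(c * ∫ z, Z z ∂P) + c ^ 2 * ∫ z, Z z ^ 2 ∂P)) /
        Real.exp (-(c * (n * s))) := by
    rw [← Real.exp_sub]; ring_nf
  rw [hexp, le_div_iff₀ (Real.exp_pos _), mul_comm]
  exact hmarkov.trans hpow

end Chernoff

/-! ### Empirical minimizers and brackets -/

section Concentration

/-- The lower tail bound with optimized parameter, for a variable whose second moment `V` satisfies
`V ≤ A * b ^ r * e ^ (2 - r)`. -/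
theorem measureReal_sum_le_le_exp_rpow {Ω : Type*} [MeasurableSpace Ω] {P : Measure Ω}
    [IsProbabilityMeasure P] {Z : Ω → ℝ} (hZ : Measurable Z) {b : ℝ} (hb : 1 ≤ b)
    (hZb : ∀ᵐ z ∂P, |Z z| ≤ 2 * b) {r : ℝ} (hr1 : 1 ≤ r) (hr2 : r ≤ 2) {A e : ℝ} (hA : 1 ≤ A)
    (he : 0 < e) (heb : e ≤ 2 * b) (hV : (e / b) ^ r * ∫ z, Z z ^ 2 ∂P ≤ A * e ^ 2) {s : ℝ}
    (hs : s + 3 / 8 * e ≤ ∫ z, Z z ∂P) (n : ℕ) :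
    (Measure.pi fun _ : Fin n => P).real {S | ∑ i, Z (S i) ≤ n * s} ≤
      Real.exp (-(n * (e / b) ^ r / (32 * A))) := by
  have hb0 : 0 < b := by linarith
  have hA0 : 0 < A := by linarith
  have hx0 : 0 < e / b := by positivity
  have hρ2 := rpow_le_two_mul hx0 ((div_le_iff₀ hb0).2 heb) hr1 hr2
  set ρ := (e / b) ^ r with hρ
  have hρ0 : 0 < ρ := Real.rpow_pos_of_pos hx0 _
  have hc0 : 0 < ρ / (8 * A * e) := by positivity
  have hcB : ρ / (8 * A * e) * (2 * b) ≤ 1 := by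
    rw [div_mul_eq_mul_div, div_le_one (by positivity)]
    calc ρ * (2 * b) ≤ 2 * (e / b) * (2 * b) := by gcongr
      _ = 4 * 1 * e := by field_simp; ring
      _ ≤ 8 * A * e := by gcongr; norm_num
  refine (measureReal_sum_le_le_exp hZ hZb hc0.le hcB n s).trans (Real.exp_le_exp.2 ?_)
  have h1 : ρ / (8 * A * e) * (s + 3 / 8 * e) ≤ ρ / (8 * A * e) * ∫ z, Z z ∂P := by gcongr
  have h2 : (ρ / (8 * A * e)) ^ 2 * ∫ z, Z z ^ 2 ∂P ≤ ρ / (64 * A) := by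
    calc (ρ / (8 * A * e)) ^ 2 * ∫ z, Z z ^ 2 ∂P
        = ρ / (8 * A * e) ^ 2 * (ρ * ∫ z, Z z ^ 2 ∂P) := by ring
      _ ≤ ρ / (8 * A * e) ^ 2 * (A * e ^ 2) := by gcongr
      _ = ρ / (64 * A) := by field_simp; ring
  have h3 : ρ / (8 * A * e) * (3 / 8 * e) = 3 * ρ / (64 * A) := by field_simp; ring
  have h4 : -(n * ρ / (32 * A)) = n * (-(3 * ρ / (64 * A)) + ρ / (64 * A)) := by
    field_simp; ring
  rw [h4]
  refine mul_le_mul_of_nonneg_left ?_ (Nat.cast_nonneg n)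
  linarith

variable {X : Type*} [MeasurableSpace X] {P : Measure (X × ℝ)} [IsProbabilityMeasure P]

/-- The pointwise least excess loss over the functions between `l` and `u`: the map
`v ↦ hinge (y * v)` is monotone, so its minimum over an interval is taken at an endpoint. -/
def lowerExcessLoss (P : Measure (X × ℝ)) [IsFiniteMeasure P] (l u : X → ℝ) (z : X × ℝ) : ℝ :=
  min (excessLoss P l z) (excessLoss P u z)

theorem lowerExcessLoss_le {l u f : X → ℝ} (h : ∀ x, l x ≤ f x ∧ f x ≤ u x) (z : X × ℝ) :
    lowerExcessLoss P l u z ≤ excessLoss P f z := by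
  obtain ⟨h1, h2⟩ := h z.1
  rcases le_total 0 z.2 with hz | hz
  · exact min_le_of_right_le
      (sub_le_sub_right (hinge_antitone (mul_le_mul_of_nonneg_left h2 hz)) _)
  · exact min_le_of_left_le
      (sub_le_sub_right (hinge_antitone (mul_le_mul_of_nonpos_left h1 hz)) _)

theorem excessLoss_sub_lowerExcessLoss_le {l u f : X → ℝ} (h : ∀ x, l x ≤ f x ∧ f x ≤ u x)
    {z : X × ℝ} (hz : z.2 = 1 ∨ z.2 = -1) :
    excessLoss P f z - lowerExcessLoss P l u z ≤ u z.1 - l z.1 := by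
  obtain ⟨h1, h2⟩ := h z.1
  have key : ∀ w : ℝ, l z.1 ≤ w → w ≤ u z.1 →
      hinge (z.2 * f z.1) - hinge (z.2 * w) ≤ u z.1 - l z.1 := by
    intro w hw1 hw2
    refine (le_abs_self _).trans ((abs_hinge_sub_le _ _).trans ?_)
    rw [← mul_sub, abs_label_mul hz, abs_le]
    constructor <;> linarith
  have hl := key (l z.1) le_rfl (h1.trans h2)
  have hu := key (u z.1) (h1.trans h2) le_rfl
  unfold lowerExcessLoss
  rw [sub_le_comm, le_min_iff]
  unfold excessLoss
  constructor <;> linarith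

/-- For functions between `l` and `u` whose excess risk is at least `e`, the empirical excess risks
exceed `e / 2` simultaneously, except on an event of exponentially small probability. The bound is
driven by the excess risk of one such function, which may be far larger than `e`. -/
theorem exists_bracket_event (hY : ∀ᵐ z ∂P, z.2 = 1 ∨ z.2 = -1) {b : ℝ} (hb : 1 ≤ b)
    {G : Set (X → ℝ)} (hGm : ∀ f ∈ G, Measurable f) (hGb : ∀ f ∈ G, ∀ x, |f x| ≤ b)
    {r : ℝ} (hr1 : 1 ≤ r) (hr2 : r ≤ 2) {A : ℝ} (hA : 0 < A)
    (hvar : ∀ f ∈ G, ∀ e : ℝ, 0 < e → e ≤ 2 * b → ∫ z, excessLoss P f z ∂P ≤ e →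
        (e / b) ^ r * ∫ z, excessLoss P f z ^ 2 ∂P ≤ A * e ^ 2)
    {l u : X → ℝ} (hl : Measurable l) (hu : Measurable u) (hlb : ∀ x, |l x| ≤ b)
    (hub : ∀ x, |u x| ≤ b) {δ : ℝ} (hδ : 0 < δ) (hlu : ∫ x, (u x - l x) ^ 2 ∂P.fst ≤ δ ^ 2)
    {e : ℝ} (he : 0 < e) (hδe : 8 * δ ≤ e) (n : ℕ) :
    ∃ T : Set (Fin n → X × ℝ), (Measure.pi fun _ : Fin n => P).real T ≤
        Real.exp (-(n * (e / b) ^ r / (32 * (2 * A + 1)))) ∧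
      ∀ S ∉ T, ∀ f ∈ G, (∀ x, l x ≤ f x ∧ f x ≤ u x) → e ≤ ∫ z, excessLoss P f z ∂P →
        n * (e / 2) < ∑ i, excessLoss P f (S i) := by
  by_cases hex : ∃ f ∈ G, (∀ x, l x ≤ f x ∧ f x ≤ u x) ∧ e ≤ ∫ z, excessLoss P f z ∂P
  swap
  · push Not at hex
    refine ⟨∅, by simpa using (Real.exp_pos _).le, fun S _ f hf h1 h2 => ?_⟩
    exact absurd h2 (not_le.2 (hex f hf h1))
  obtain ⟨f, hf, hfb, hfe⟩ := hex
  have hb0 : 0 < b := by linarith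
  set Z := lowerExcessLoss P l u with hZ
  refine ⟨{S | ∑ i, Z (S i) ≤ n * (e / 2)}, ?_, ?_⟩
  swap
  · intro S hS g _ hg2 _
    simp only [Set.mem_ofPred_eq, not_le] at hS
    exact hS.trans_le (Finset.sum_le_sum fun i _ => lowerExcessLoss_le hg2 (S i))
  set e' := ∫ z, excessLoss P f z ∂P with he'
  have he0' : 0 < e' := he.trans_le hfe
  have heb' : e' ≤ 2 * b := integral_excessLoss_le hY (hGm f hf) hb (hGb f hf)
  have hZm : Measurable Z := (measurable_excessLoss P hl).min (measurable_excessLoss P hu)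
  have hZb : ∀ᵐ z ∂P, |Z z| ≤ 2 * b := by
    filter_upwards [ae_abs_excessLoss_le hY hb hlb, ae_abs_excessLoss_le hY hb hub] with z h1 h2
    rcases min_choice (excessLoss P l z) (excessLoss P u z) with h | h
    · rwa [hZ, lowerExcessLoss, h]
    · rwa [hZ, lowerExcessLoss, h]
  have hiZ : Integrable Z P := Integrable.of_bound hZm.aestronglyMeasurable (2 * b) hZb
  have hiZ2 : Integrable (fun z => Z z ^ 2) P := by
    refine Integrable.of_bound (hZm.pow_const 2).aestronglyMeasurable ((2 * b) ^ 2) ?_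
    filter_upwards [hZb] with z hz
    rw [Real.norm_eq_abs, abs_pow]
    gcongr
  have hi := integrable_excessLoss hY (hGm f hf) hb (hGb f hf)
  have hi2 := integrable_excessLoss_sq hY (hGm f hf) hb (hGb f hf)
  -- the width of the bracket, as a function of the labelled point
  set D : X × ℝ → ℝ := fun z => u z.1 - l z.1 with hD
  have hDm : Measurable D := by fun_prop
  have hDb : ∀ z, |D z| ≤ 2 * b := fun z => by
    have := (abs_sub (u z.1) (l z.1)).trans (add_le_add (hub _) (hlb _))
    linarith
  have hiD2 : Integrable (fun z => D z ^ 2) P := by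
    refine Integrable.of_bound (hDm.pow_const 2).aestronglyMeasurable ((2 * b) ^ 2)
      (ae_of_all _ fun z => ?_)
    rw [Real.norm_eq_abs, abs_pow]
    exact pow_le_pow_left₀ (abs_nonneg _) (hDb z) 2
  have hD2 : ∫ z, D z ^ 2 ∂P ≤ δ ^ 2 := by
    rw [Measure.fst, integral_map measurable_fst.aemeasurable (by fun_prop)] at hlu
    exact hlu
  have hdiff : ∀ᵐ z ∂P, 0 ≤ excessLoss P f z - Z z ∧ excessLoss P f z - Z z ≤ D z := by
    filter_upwards [hY] with z hz
    exact ⟨sub_nonneg.2 (lowerExcessLoss_le hfb z), excessLoss_sub_lowerExcessLoss_le hfb hz⟩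
  have hmean : e' - δ ≤ ∫ z, Z z ∂P := by
    have : ∫ z, (excessLoss P f z - Z z) ∂P ≤ ∫ z, (D z ^ 2 / (2 * δ) + δ / 2) ∂P := by
      refine integral_mono_ae (hi.sub hiZ) ((hiD2.div_const _).add (integrable_const _)) ?_
      filter_upwards [hdiff] with z hz
      refine hz.2.trans ?_
      have : D z ^ 2 / (2 * δ) + δ / 2 - D z = (D z - δ) ^ 2 / (2 * δ) := by field_simp; ring
      have h2 : 0 ≤ (D z - δ) ^ 2 / (2 * δ) := by positivity
      linarith
    rw [integral_sub hi hiZ, integral_add (hiD2.div_const _) (integrable_const _),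
      integral_div, integral_const, probReal_univ, one_smul] at this
    have h2 : (∫ z, D z ^ 2 ∂P) / (2 * δ) ≤ δ ^ 2 / (2 * δ) := by gcongr
    have h3 : δ ^ 2 / (2 * δ) = δ / 2 := by field_simp
    linarith
  have hsq : ∫ z, Z z ^ 2 ∂P ≤ 2 * ∫ z, excessLoss P f z ^ 2 ∂P + 2 * δ ^ 2 := by
    calc ∫ z, Z z ^ 2 ∂P ≤ ∫ z, (2 * excessLoss P f z ^ 2 + 2 * D z ^ 2) ∂P := by
          refine integral_mono_ae hiZ2 ((hi2.const_mul 2).add (hiD2.const_mul 2)) ?_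
          filter_upwards [hdiff] with z hz
          have h1 : (excessLoss P f z - Z z) ^ 2 ≤ D z ^ 2 := pow_le_pow_left₀ hz.1 hz.2 2
          nlinarith [sq_nonneg (2 * excessLoss P f z - Z z)]
      _ = 2 * ∫ z, excessLoss P f z ^ 2 ∂P + 2 * ∫ z, D z ^ 2 ∂P := by
          rw [integral_add (hi2.const_mul 2) (hiD2.const_mul 2), integral_const_mul,
            integral_const_mul]
      _ ≤ _ := by gcongr
  have hρ0 : 0 < (e' / b) ^ r := Real.rpow_pos_of_pos (by positivity) _
  have hρ4 : (e' / b) ^ r ≤ 4 := by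
    have h1 : e' / b ≤ 2 := (div_le_iff₀ hb0).2 heb'
    have := rpow_le_two_mul (x := e' / b) (by positivity) h1 hr1 hr2
    linarith
  have hδ2 : δ ^ 2 ≤ (e' / 8) ^ 2 := by gcongr; linarith
  have hV : (e' / b) ^ r * ∫ z, Z z ^ 2 ∂P ≤ (2 * A + 1) * e' ^ 2 := by
    calc (e' / b) ^ r * ∫ z, Z z ^ 2 ∂P
        ≤ (e' / b) ^ r * (2 * ∫ z, excessLoss P f z ^ 2 ∂P + 2 * δ ^ 2) := by gcongr
      _ = 2 * ((e' / b) ^ r * ∫ z, excessLoss P f z ^ 2 ∂P) + (e' / b) ^ r * (2 * δ ^ 2) := by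
          ring
      _ ≤ 2 * (A * e' ^ 2) + 4 * (2 * (e' / 8) ^ 2) := by
          refine add_le_add
            (mul_le_mul_of_nonneg_left (hvar f hf e' he0' heb' le_rfl) two_pos.le) ?_
          gcongr
      _ ≤ (2 * A + 1) * e' ^ 2 := by nlinarith
  refine (measureReal_sum_le_le_exp_rpow hZm hb hZb hr1 hr2 (by linarith) he0' heb' hV
    (s := e / 2) (by linarith) n).trans (Real.exp_le_exp.2 (neg_le_neg ?_))
  gcongr

/-- A sample outside the exceptional event forces every empirical minimizer over `G` to have excess
hinge risk below `e`. The event is a union over the brackets and one further event, which controls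
the empirical risk of the approximating function `f₀`. -/
theorem exists_event_of_brackets (hY : ∀ᵐ z ∂P, z.2 = 1 ∨ z.2 = -1) {b : ℝ} (hb : 1 ≤ b)
    {G : Set (X → ℝ)} (hGm : ∀ f ∈ G, Measurable f) (hGb : ∀ f ∈ G, ∀ x, |f x| ≤ b)
    {r : ℝ} (hr1 : 1 ≤ r) (hr2 : r ≤ 2) {A : ℝ} (hA : 0 < A)
    (hvar : ∀ f ∈ G, ∀ e : ℝ, 0 < e → e ≤ 2 * b → ∫ z, excessLoss P f z ∂P ≤ e →
        (e / b) ^ r * ∫ z, excessLoss P f z ^ 2 ∂P ≤ A * e ^ 2)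
    {N : ℕ} {l u : Fin N → X → ℝ} (hl : ∀ i, Measurable (l i)) (hu : ∀ i, Measurable (u i))
    (hlb : ∀ i x, |l i x| ≤ b) (hub : ∀ i x, |u i x| ≤ b) {δ : ℝ} (hδ : 0 < δ)
    (hlu : ∀ i, ∫ x, (u i x - l i x) ^ 2 ∂P.fst ≤ δ ^ 2)
    (hcover : ∀ f ∈ G, ∃ i, ∀ x, l i x ≤ f x ∧ f x ≤ u i x)
    {e : ℝ} (he : 0 < e) (heb : e ≤ 2 * b) (hδe : 8 * δ ≤ e)
    {f₀ : X → ℝ} (hf₀ : f₀ ∈ G) (hf₀e : 8 * ∫ z, excessLoss P f₀ z ∂P ≤ e)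
    {n : ℕ} (hn : 0 < n) :
    ∃ T : Set (Fin n → X × ℝ), (Measure.pi fun _ : Fin n => P).real T ≤
        (N + 1) * Real.exp (-(n * (e / b) ^ r / (32 * (2 * A + 1)))) ∧
      ∀ S ∉ T, ∀ f, IsEmpiricalMinimizer hinge S G f → ∫ z, excessLoss P f z ∂P < e := by
  choose T hT1 hT2 using fun i => exists_bracket_event hY hb hGm hGb hr1 hr2 hA hvar (hl i) (hu i)
    (hlb i) (hub i) hδ (hlu i) he hδe n
  set T₀ : Set (Fin n → X × ℝ) := {S | ∑ i, -excessLoss P f₀ (S i) ≤ n * (-(e / 2))} with hT₀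
  have hT₀1 : (Measure.pi fun _ : Fin n => P).real T₀ ≤
      Real.exp (-(n * (e / b) ^ r / (32 * (2 * A + 1)))) := by
    refine measureReal_sum_le_le_exp_rpow (Z := fun z => -excessLoss P f₀ z)
      (measurable_excessLoss P (hGm f₀ hf₀)).neg hb ?_ hr1 hr2 (by linarith) he heb ?_ ?_ n
    · filter_upwards [ae_abs_excessLoss_le hY hb (hGb f₀ hf₀)] with z hz
      rwa [abs_neg]
    · simp only [neg_sq]
      refine (hvar f₀ hf₀ e he heb (by linarith)).trans ?_
      gcongr
      linarith
    · rw [integral_neg]; linarith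
  refine ⟨(⋃ i, T i) ∪ T₀, ?_, ?_⟩
  · calc (Measure.pi fun _ : Fin n => P).real ((⋃ i, T i) ∪ T₀)
        ≤ ∑ i, (Measure.pi fun _ : Fin n => P).real (T i) +
          (Measure.pi fun _ : Fin n => P).real T₀ :=
          (measureReal_union_le _ _).trans (add_le_add_left (measureReal_iUnion_fintype_le _) _)
      _ ≤ ∑ _i : Fin N, Real.exp (-(n * (e / b) ^ r / (32 * (2 * A + 1)))) +
          Real.exp (-(n * (e / b) ^ r / (32 * (2 * A + 1)))) :=
          add_le_add (Finset.sum_le_sum fun i _ => hT1 i) hT₀1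
      _ = _ := by
          rw [Finset.sum_const, Finset.card_univ, Fintype.card_fin, nsmul_eq_mul]; ring
  · intro S hS f hf
    rw [Set.mem_union, not_or, Set.mem_iUnion, not_exists] at hS
    by_contra! hcon
    obtain ⟨i, hi⟩ := hcover f hf.1
    have h1 := hT2 i S (hS.1 i) f hf.1 hi hcon
    have h2 := hS.2
    simp only [hT₀, Set.mem_ofPred_eq, not_le, Finset.sum_neg_distrib] at h2
    have h3 := hf.2 f₀ hf₀
    unfold empiricalPhiRisk at h3
    rw [div_le_div_iff_of_pos_right (by exact_mod_cast hn)] at h3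
    have h4 : ∑ i, excessLoss P f (S i) ≤ ∑ i, excessLoss P f₀ (S i) := by
      simp only [excessLoss, Finset.sum_sub_distrib]
      linarith
    linarith

end Concentration

/-! ### Bracketing sets and the bound for a fixed sample size -/

section Brackets

variable {X : Type*} [MeasurableSpace X]

theorem exists_isBracketing_of_bracketingEntropy_le {μ : Measure X} {p : ℝ≥0∞} {δ : ℝ}
    {G : Set (X → ℝ)} {c : ℝ} (h : bracketingEntropy μ p δ G ≤ (c : EReal)) :
    ∃ (N : ℕ) (l u : Fin N → X → ℝ), IsBracketing μ p δ G N l u ∧ (N : ℝ) ≤ Real.exp c := by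
  have h1 : ((bracketingNumber μ p δ G : ℕ∞) : ℝ≥0∞) ≤ ENNReal.ofReal (Real.exp c) := by
    rw [← EReal.exp_coe, ← ENNReal.exp_log ((bracketingNumber μ p δ G : ℕ∞) : ℝ≥0∞)]
    exact EReal.exp_monotone h
  obtain ⟨N, hN⟩ := ENat.exists_eq_iInf fun N : ℕ =>
    ⨅ _ : ∃ l u : Fin N → X → ℝ, IsBracketing μ p δ G N l u, (N : ℕ∞)
  by_cases hex : ∃ l u : Fin N → X → ℝ, IsBracketing μ p δ G N l u
  · obtain ⟨l, u, hlu⟩ := hex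
    refine ⟨N, l, u, hlu, ?_⟩
    have h2 : bracketingNumber μ p δ G = N := by
      rw [bracketingNumber, ← hN, iInf_pos ⟨l, u, hlu⟩]
    rw [h2, ENat.toENNReal_coe] at h1
    have h3 := ENNReal.toReal_mono ENNReal.ofReal_ne_top h1
    rwa [ENNReal.toReal_natCast, ENNReal.toReal_ofReal (Real.exp_pos _).le] at h3
  · have h2 : bracketingNumber μ p δ G = ⊤ := by
      rw [bracketingNumber, ← hN, iInf_neg hex]
    rw [h2, ENat.toENNReal_top, top_le_iff] at h1
    exact absurd h1 ENNReal.ofReal_ne_top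

theorem abs_clamp_le {b : ℝ} (hb : 0 ≤ b) (x : ℝ) : |max (-b) (min b x)| ≤ b :=
  abs_le.2 ⟨le_max_left _ _, max_le (by linarith) (min_le_left _ _)⟩

theorem clamp_eq_self {b x : ℝ} (hx : |x| ≤ b) : max (-b) (min b x) = x := by
  obtain ⟨h1, h2⟩ := abs_le.1 hx
  rw [min_eq_right h2, max_eq_right h1]

theorem abs_clamp_sub_clamp_le (b x y : ℝ) :
    |max (-b) (min b x) - max (-b) (min b y)| ≤ |x - y| := by
  refine (abs_max_sub_max_le_max _ _ _ _).trans ?_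
  rw [sub_self, abs_zero, max_eq_right (abs_nonneg _)]
  refine (abs_min_sub_min_le_max _ _ _ _).trans ?_
  rw [sub_self, abs_zero, max_eq_right (abs_nonneg _)]

/-- The brackets of a class bounded by `b` may be clamped to `[-b, b]`, which does not widen them.
-/
theorem IsBracketing.clamp {μ : Measure X} {p : ℝ≥0∞} {δ b : ℝ} {G : Set (X → ℝ)} {N : ℕ}
    {l u : Fin N → X → ℝ} (h : IsBracketing μ p δ G N l u) (hG : ∀ f ∈ G, ∀ x, |f x| ≤ b) :
    IsBracketing μ p δ G N (fun i x => max (-b) (min b (l i x)))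
      (fun i x => max (-b) (min b (u i x))) := by
  refine ⟨fun i => ⟨?_, ?_, ?_⟩, fun f hf => ?_⟩
  · exact measurable_const.max (measurable_const.min (h.1 i).1)
  · exact measurable_const.max (measurable_const.min (h.1 i).2.1)
  · refine (eLpNorm_mono fun x => ?_).trans (h.1 i).2.2
    exact abs_clamp_sub_clamp_le b _ _
  · obtain ⟨i, hi⟩ := h.2 f hf
    refine ⟨i, fun x => ?_⟩
    rw [← clamp_eq_self (hG f hf x)]
    exact ⟨max_le_max_left _ (min_le_min_left _ (hi x).1),
      max_le_max_left _ (min_le_min_left _ (hi x).2)⟩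

/-- Transfer of an `L²(μ)` bound to a measure dominated by `κ • μ`. -/
theorem integral_sq_le_of_eLpNorm_le {ν μ : Measure X} {κ : ℝ≥0} (hν : ν ≤ κ • μ) {h : X → ℝ}
    (hm : Measurable h) {δ : ℝ} (hδ : 0 ≤ δ) (hle : eLpNorm h 2 μ ≤ ENNReal.ofReal δ) :
    ∫ x, h x ^ 2 ∂ν ≤ κ * δ ^ 2 := by
  rw [integral_eq_lintegral_of_nonneg_ae (ae_of_all _ fun _ => sq_nonneg _)
    (hm.pow_const 2).aestronglyMeasurable]
  refine ENNReal.toReal_le_of_le_ofReal (by positivity) ?_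
  have h2 : eLpNorm h 2 μ ^ 2 = ∫⁻ x, ENNReal.ofReal (h x ^ 2) ∂μ := by
    have := eLpNorm_nnreal_pow_eq_lintegral (f := h) (μ := μ) (p := 2) two_ne_zero
    simp only [NNReal.coe_ofNat, ENNReal.rpow_ofNat, ENNReal.coe_ofNat] at this
    rw [this]
    refine lintegral_congr fun x => ?_
    rw [Real.enorm_eq_ofReal_abs, ← ENNReal.ofReal_pow (abs_nonneg _), sq_abs]
  calc ∫⁻ x, ENNReal.ofReal (h x ^ 2) ∂ν ≤ ∫⁻ x, ENNReal.ofReal (h x ^ 2) ∂(κ • μ) :=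
        lintegral_mono' hν le_rfl
    _ = κ * eLpNorm h 2 μ ^ 2 := by rw [lintegral_smul_measure, h2]; rfl
    _ ≤ κ * ENNReal.ofReal δ ^ 2 := by gcongr
    _ = ENNReal.ofReal (κ * δ ^ 2) := by
        rw [ENNReal.ofReal_mul κ.coe_nonneg, ENNReal.ofReal_coe_nnreal, ENNReal.ofReal_pow hδ]

end Brackets

section Rate

theorem integral_le_add_measureReal {Ω : Type*} [MeasurableSpace Ω] {ν : Measure Ω}
    [IsProbabilityMeasure ν] {g : Ω → ℝ} (hg : AEMeasurable g ν) (hg1 : ∀ S, |g S| ≤ 1) {e : ℝ}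
    (he : 0 ≤ e) {T : Set Ω} (hT : ∀ᵐ S ∂ν, S ∉ T → g S ≤ e) :
    ∫ S, g S ∂ν ≤ e + ν.real T := by
  have hTm := measurableSet_toMeasurable ν T
  have hi : Integrable ((toMeasurable ν T).indicator (1 : Ω → ℝ)) ν :=
    (integrable_const (1 : ℝ)).indicator hTm
  calc ∫ S, g S ∂ν ≤ ∫ S, (e + (toMeasurable ν T).indicator 1 S) ∂ν := by
        refine integral_mono_ae (Integrable.of_bound hg.aestronglyMeasurable 1 (ae_of_all _ hg1))
          ((integrable_const e).add hi) ?_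
        filter_upwards [hT] with S hS
        by_cases h : S ∈ toMeasurable ν T
        · rw [Set.indicator_of_mem h]
          have := le_of_abs_le (hg1 S)
          simp only [Pi.one_apply]
          linarith
        · rw [Set.indicator_of_notMem h, add_zero]
          exact hS fun h' => h (subset_toMeasurable ν T h')
    _ = e + ν.real T := by
        rw [integral_add (integrable_const e) hi, integral_indicator_one hTm, integral_const,
          probReal_univ, one_smul, Measure.real, Measure.real, measure_toMeasurable]

theorem abs_excessRisk01_le_one {X : Type*} [MeasurableSpace X] {P : Measure (X × ℝ)}
    [IsProbabilityMeasure P] (f C : X → ℝ) : |excessRisk01 P f C| ≤ 1 := by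
  have h : ∀ g : X → ℝ, 0 ≤ risk01 P g ∧ risk01 P g ≤ 1 := fun g =>
    ⟨measureReal_nonneg, measureReal_le_one⟩
  unfold excessRisk01
  rw [abs_le]
  constructor <;> linarith [h f, h C]

/-- The bound for a fixed sample size: if the log-cardinality of the bracketing set is at most half
of the exponent of the tail bound, the union bound over the brackets costs only a constant. -/
theorem integral_excessRisk01_le {X : Type*} [MeasurableSpace X] {P : Measure (X × ℝ)}
    [IsProbabilityMeasure P] (hY : ∀ᵐ z ∂P, z.2 = 1 ∨ z.2 = -1) {C : X → ℝ} (hC : IsClassifier C)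
    {b : ℝ} (hb : 1 ≤ b) {G : Set (X → ℝ)} (hGm : ∀ f ∈ G, Measurable f)
    (hGb : ∀ f ∈ G, ∀ x, |f x| ≤ b) {r : ℝ} (hr1 : 1 ≤ r) (hr2 : r ≤ 2) {A : ℝ} (hA : 0 < A)
    (hvar : ∀ f ∈ G, ∀ e : ℝ, 0 < e → e ≤ 2 * b → ∫ z, excessLoss P f z ∂P ≤ e →
        (e / b) ^ r * ∫ z, excessLoss P f z ^ 2 ∂P ≤ A * e ^ 2)
    {μ : Measure X} {κ : ℝ≥0} (hμ : P.fst ≤ κ • μ) {δ : ℝ} (hδ : 0 < δ)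
    {e : ℝ} (he : 0 < e) (heb : e ≤ 2 * b) (hδe : 8 * ((κ + 1) * δ) ≤ e) {n : ℕ} (hn : 0 < n)
    (hent : bracketingEntropy μ 2 δ G ≤
      ((n * (e / b) ^ r / (64 * (2 * A + 1)) : ℝ) : EReal))
    {f₀ : X → ℝ} (hf₀ : f₀ ∈ G) (hf₀e : 8 * ∫ z, excessLoss P f₀ z ∂P ≤ e)
    {fhat : (Fin n → X × ℝ) → X → ℝ}
    (hfhat : ∀ᵐ S ∂Measure.pi (fun _ : Fin n => P), IsEmpiricalMinimizer hinge S G (fhat S))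
    (hfhat_meas : AEMeasurable (fun S => excessRisk01 P (fhat S) C)
      (Measure.pi (fun _ : Fin n => P))) :
    ∫ S, excessRisk01 P (fhat S) C ∂Measure.pi (fun _ : Fin n => P) ≤
      e + 2 * Real.exp (-(n * (e / b) ^ r / (64 * (2 * A + 1)))) := by
  obtain ⟨N, l, u, hlu, hN⟩ := exists_isBracketing_of_bracketingEntropy_le hent
  have hlu' := hlu.clamp hGb
  set w := n * (e / b) ^ r / (64 * (2 * A + 1)) with hw
  have hb0 : 0 < b := by linarith
  have hw0 : 0 ≤ w := by positivity
  have hδ' : 0 < (κ + 1) * δ := by positivity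
  obtain ⟨T, hT1, hT2⟩ := exists_event_of_brackets hY hb hGm hGb hr1 hr2 hA hvar
    (fun i => (hlu'.1 i).1) (fun i => (hlu'.1 i).2.1) (fun i x => abs_clamp_le hb0.le _)
    (fun i x => abs_clamp_le hb0.le _) hδ' (fun i => by
      refine (integral_sq_le_of_eLpNorm_le hμ ((hlu'.1 i).2.1.sub (hlu'.1 i).1) hδ.le
        (hlu'.1 i).2.2).trans ?_
      rw [mul_pow]
      gcongr
      have := κ.coe_nonneg
      nlinarith)
    hlu'.2 he heb hδe hf₀ hf₀e hn
  have hT3 : (Measure.pi fun _ : Fin n => P).real T ≤ 2 * Real.exp (-w) := by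
    refine hT1.trans ?_
    have h1 : -(n * (e / b) ^ r / (32 * (2 * A + 1))) = -w + -w := by
      rw [hw]; field_simp; ring
    rw [h1, Real.exp_add, ← mul_assoc]
    refine mul_le_mul_of_nonneg_right ?_ (Real.exp_pos _).le
    have h2 : (N : ℝ) + 1 ≤ 2 * Real.exp w := by
      linarith [Real.one_le_exp hw0]
    calc ((N : ℝ) + 1) * Real.exp (-w) ≤ 2 * Real.exp w * Real.exp (-w) := by gcongr
      _ = 2 := by rw [mul_assoc, ← Real.exp_add, add_neg_cancel, Real.exp_zero, mul_one]
  refine (integral_le_add_measureReal hfhat_meas (fun S => abs_excessRisk01_le_one _ _) he.le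
    (T := T) ?_).trans (by gcongr)
  filter_upwards [hfhat] with S hS hST
  exact (excessRisk01_le_integral_excessLoss hY (hGm _ hS.1) hb (hGb _ hS.1) hC).trans
    (hT2 S hST _ hS).le

/-- Stretched exponentials decay faster than `1 / n`. -/
theorem eventually_exp_neg_rpow_le {c ι M : ℝ} (hc : 0 < c) (hι : 0 < ι) (hM : 0 < M) :
    ∀ᶠ n : ℕ in atTop, Real.exp (-(c * (n : ℝ) ^ ι)) ≤ M / n := by
  have h1 : Tendsto (fun n : ℕ => (n : ℝ) ^ ι) atTop atTop :=
    (tendsto_rpow_atTop hι).comp tendsto_natCast_atTop_atTop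
  have h2 := ((isLittleO_exp_neg_mul_rpow_atTop hc (-(1 / ι))).comp_tendsto h1).bound hM
  filter_upwards [h2] with n hn
  have h3 : ((n : ℝ) ^ ι) ^ (-(1 / ι)) = (n : ℝ)⁻¹ := by
    rw [← Real.rpow_mul (Nat.cast_nonneg n), mul_neg, mul_one_div_cancel hι.ne',
      Real.rpow_neg_one]
  simp only [Function.comp_apply, h3, Real.norm_eq_abs, Real.abs_exp] at hn
  rw [abs_of_nonneg (by positivity), ← div_eq_mul_inv] at hn
  rwa [← neg_mul]

end Rate

end

end HingeRate

/-! ### The rate -/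

theorem mainTheorem6 {d : ℕ}
    -- the law of `(X, Y)` on `[0,1]^d × {-1, 1}`
    (P : Measure (HingeRate.Cube d × ℝ)) [IsProbabilityMeasure P]
    (hY : ∀ᵐ z ∂P, z.2 = 1 ∨ z.2 = -1)
    -- the reference measure of the bracketing entropy, which dominates the law of `X`
    (μ : Measure (HingeRate.Cube d)) (κ : ℝ≥0) (hμ : P.fst ≤ κ • μ)
    (q : ℝ≥0∞) (hN : HingeRate.NoiseCondition P q)
    (Cstar : HingeRate.Cube d → ℝ) (hC : HingeRate.IsBayesClassifier P Cstar)
    (fstar : HingeRate.Cube d → ℝ) (hf : HingeRate.IsPhiRiskMinimizer HingeRate.hinge P fstar)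
    (𝓕 : ℕ → Set (HingeRate.Cube d → ℝ)) (hmeas : ∀ n, 1 ≤ n → ∀ f ∈ 𝓕 n, Measurable f)
    (a F δ ε : ℕ → ℝ)
    (hA2 : HingeRate.ConditionA2 HingeRate.hinge P fstar 𝓕 a)
    (hA3 : HingeRate.ConditionA3 𝓕 F)
    (hA5 : HingeRate.ConditionA5 μ 𝓕 F δ (HingeRate.nuExponent q))
    (hε : HingeRate.Asymp (fun n => ε n ^ 2) (fun n => max (a n) (δ n)))
    (ι : ℝ) (hι : 0 < ι)
    (hrate : HingeRate.Lesssim (fun _ => 1)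
      (fun n => (n : ℝ) ^ (1 - ι) * (ε n ^ 2 / F n) ^ HingeRate.rateExponent q))
    -- the empirical hinge-risk minimizer, as a function of the i.i.d. training sample
    (fhat : ∀ n : ℕ, (Fin n → HingeRate.Cube d × ℝ) → HingeRate.Cube d → ℝ)
    (hfhat : ∀ n, 1 ≤ n → ∀ᵐ S ∂Measure.pi (fun _ : Fin n => P),
      HingeRate.IsEmpiricalMinimizer HingeRate.hinge S (𝓕 n) (fhat n S))
    (hfhat_meas : ∀ n, 1 ≤ n →
      AEMeasurable (fun S => HingeRate.excessRisk01 P (fhat n S) Cstar)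
        (Measure.pi (fun _ : Fin n => P))) :
    HingeRate.Lesssim
      (fun n => ∫ S, HingeRate.excessRisk01 P (fhat n S) Cstar ∂Measure.pi (fun _ : Fin n => P))
      (fun n => ε n ^ 2) := by
  obtain ⟨A, hA, hvar⟩ := HingeRate.exists_integral_excessLoss_sq_le hY hN
  obtain ⟨ha0, -, happ⟩ := hA2
  obtain ⟨-, ⟨CF, hCF, hF⟩, hFb⟩ := hA3
  obtain ⟨hδ0, C₃, hC₃, hent⟩ := hA5
  obtain ⟨-, Cε, hCε, hεle⟩ := hε
  obtain ⟨Ch, hCh, hrate⟩ := hrate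
  rw [HingeRate.two_sub_nuExponent] at hent
  have hr1 := HingeRate.one_le_rateExponent q
  have hr2 := HingeRate.rateExponent_le_two q
  set r := HingeRate.rateExponent q with hr
  -- half of the constant in the exponent of the tail bound
  set c : ℝ := 1 / (64 * (2 * A + 1)) with hc
  have hc0 : 0 < c := by positivity
  -- `b = D * F n` is a bound of the class that is at least `1`
  set D : ℝ := max 1 CF with hD
  have hD1 : 1 ≤ D := le_max_left _ _
  have hDF : CF ≤ D := le_max_right _ _
  have hκ : (0 : ℝ) ≤ κ := κ.coe_nonneg
  -- the last two summands make the entropy at most half of the exponent of the tail bound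
  set K : ℝ := 8 * Cε + 8 * ((κ + 1) * Cε) + D + D * Cε + C₃ * (D * Cε) / c with hK
  have hp1 : 0 ≤ 8 * Cε := by positivity
  have hp2 : 0 ≤ 8 * ((κ + 1) * Cε) := by positivity
  have hp3 : 0 ≤ D * Cε := by positivity
  have hp4 : 0 ≤ C₃ * (D * Cε) / c := by positivity
  have hKD : D ≤ K := by linarith
  have hK0 : 0 < K := by linarith
  have hM : 0 < min 1 (1 / Ch) / 2 := by positivity
  refine ⟨K + CF, by positivity, ?_⟩
  filter_upwards [hF, hεle, hrate, eventually_ge_atTop 1,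
    HingeRate.eventually_exp_neg_rpow_le (c := c / Ch) (by positivity) hι hM]
    with n hFn hεn hraten hn hexp
  have hn0 : (0 : ℝ) < n := by exact_mod_cast hn
  have hn1 : (1 : ℝ) ≤ n := by exact_mod_cast hn
  have han : a n ≤ Cε * ε n ^ 2 := (le_max_left _ _).trans hεn
  have hδn : δ n ≤ Cε * ε n ^ 2 := (le_max_right _ _).trans hεn
  have hE0 : 0 < ε n ^ 2 := pos_of_mul_pos_right ((hδ0 n hn).trans_le hδn) hCε.le
  set E := ε n ^ 2 with hE
  have hF0 : 0 < F n := pos_of_mul_pos_right (one_pos.trans_le hFn) hCF.le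
  have hb : 1 ≤ D * F n := hFn.trans (by gcongr)
  have hb0 : 0 < D * F n := by linarith
  rcases le_or_gt 1 (K * E) with hbig | hsmall
  · have h := HingeRate.integral_le_add_measureReal (hfhat_meas n hn)
      (fun S => HingeRate.abs_excessRisk01_le_one _ _) zero_le_one (T := ∅)
      (ae_of_all _ fun S _ => le_of_abs_le (HingeRate.abs_excessRisk01_le_one _ _))
    rw [measureReal_empty, add_zero] at h
    have : 0 ≤ CF * E := by positivity
    linarith
  have hKE0 : 0 < K * E := by positivity
  have hfb : ∀ f ∈ 𝓕 n, ∀ x, |f x| ≤ D * F n := fun f hf x =>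
    (hFb n hn f hf x).trans (le_mul_of_one_le_left hF0.le hD1)
  obtain ⟨f₀, hf₀, hf₀a⟩ := happ n hn
  have hf₀e : 8 * ∫ z, HingeRate.excessLoss P f₀ z ∂P ≤ K * E := by
    have h1 := HingeRate.integral_excessLoss_le_excessPhiRisk hY (hmeas n hn f₀ hf₀) (hfb f₀ hf₀) hf
    have h2 : 8 * Cε * E ≤ K * E := by gcongr; linarith
    linarith
  have hδe : 8 * ((κ + 1) * δ n) ≤ K * E := by
    calc 8 * ((κ + 1) * δ n) ≤ 8 * ((κ + 1) * (Cε * E)) := by gcongr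
      _ = 8 * ((κ + 1) * Cε) * E := by ring
      _ ≤ K * E := by gcongr; linarith
  set x := K * E / (D * F n) with hx
  have hx0 : 0 < x := by positivity
  have hent' : C₃ * n * (δ n / F n) ^ r ≤ n * x ^ r / (64 * (2 * A + 1)) := by
    have h1 : δ n / F n ≤ D * Cε / K * x := by
      calc δ n / F n ≤ Cε * E / F n := by gcongr
        _ = D * Cε / K * x := by rw [hx]; field_simp
    have hθ1 : D * Cε / K ≤ 1 := (div_le_one hK0).2 (by linarith)
    have h2 : (δ n / F n) ^ r ≤ D * Cε / K * x ^ r := by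
      calc (δ n / F n) ^ r ≤ (D * Cε / K * x) ^ r :=
            Real.rpow_le_rpow (div_nonneg (hδ0 n hn).le hF0.le) h1 (by linarith)
        _ = (D * Cε / K) ^ r * x ^ r := Real.mul_rpow (by positivity) hx0.le
        _ ≤ D * Cε / K * x ^ r := by
            gcongr
            calc (D * Cε / K) ^ r ≤ (D * Cε / K) ^ (1 : ℝ) :=
                  Real.rpow_le_rpow_of_exponent_ge (by positivity) hθ1 hr1
              _ = _ := Real.rpow_one _
    have h3 : C₃ * (D * Cε / K) ≤ c := by
      rw [mul_div_assoc', div_le_iff₀ hK0, ← div_le_iff₀' hc0]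
      linarith
    calc C₃ * n * (δ n / F n) ^ r ≤ C₃ * n * (D * Cε / K * x ^ r) := by gcongr
      _ = C₃ * (D * Cε / K) * (n * x ^ r) := by ring
      _ ≤ c * (n * x ^ r) := by gcongr
      _ = _ := by rw [hc]; ring
  have hmain := HingeRate.integral_excessRisk01_le hY hC.1 hb (hmeas n hn) hfb hr1 hr2 hA
    (fun f hf => hvar _ hb f (hmeas n hn f hf) (hfb f hf)) hμ (hδ0 n hn) hKE0
    (by linarith) hδe hn ((hent n hn).trans (EReal.coe_le_coe_iff.2 hent')) hf₀ hf₀e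
    (hfhat n hn) (hfhat_meas n hn)
  -- the growth condition bounds the exponent of the tail below by a power of `n`
  have hnpow : (n : ℝ) ^ ι * (n : ℝ) ^ (1 - ι) = n := by
    rw [← Real.rpow_add hn0, add_sub_cancel, Real.rpow_one]
  have hEF : (E / F n) ^ r ≤ x ^ r := by
    refine Real.rpow_le_rpow (by positivity) ?_ (by linarith)
    rw [hx, div_le_div_iff₀ hF0 hb0]
    calc E * (D * F n) = D * E * F n := by ring
      _ ≤ K * E * F n := by gcongr
  have htail : c / Ch * (n : ℝ) ^ ι ≤ n * x ^ r / (64 * (2 * A + 1)) := by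
    calc c / Ch * (n : ℝ) ^ ι = c / Ch * (n : ℝ) ^ ι * 1 := (mul_one _).symm
      _ ≤ c / Ch * (n : ℝ) ^ ι * (Ch * ((n : ℝ) ^ (1 - ι) * (E / F n) ^ r)) := by gcongr
      _ = c * ((n : ℝ) ^ ι * (n : ℝ) ^ (1 - ι)) * (E / F n) ^ r := by field_simp
      _ ≤ c * n * x ^ r := by rw [hnpow]; gcongr
      _ = _ := by rw [hc]; ring
  have htail2 : 2 * Real.exp (-(n * x ^ r / (64 * (2 * A + 1)))) ≤ min 1 (1 / Ch) / n := by
    have h1 := (Real.exp_le_exp.2 (neg_le_neg htail)).trans hexp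
    calc 2 * Real.exp (-(n * x ^ r / (64 * (2 * A + 1)))) ≤ 2 * (min 1 (1 / Ch) / 2 / n) := by
          gcongr
      _ = _ := by ring
  -- the growth condition also bounds `ε n ^ 2` below by a multiple of `1 / n`
  have hlow : min 1 (1 / Ch) / n ≤ CF * E := by
    have hw : E / F n ≤ CF * E := by
      rw [div_le_iff₀ hF0]
      calc E = E * 1 := (mul_one _).symm
        _ ≤ E * (CF * F n) := by gcongr
        _ = CF * E * F n := by ring
    rcases le_or_gt 1 (CF * E) with h1 | h1
    · refine le_trans ?_ h1
      rw [div_le_one hn0]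
      exact (min_le_left _ _).trans hn1
    · have h2 : (E / F n) ^ r ≤ CF * E := by
        calc (E / F n) ^ r ≤ (CF * E) ^ r := Real.rpow_le_rpow (by positivity) hw (by linarith)
          _ ≤ (CF * E) ^ (1 : ℝ) :=
              Real.rpow_le_rpow_of_exponent_ge (by positivity) h1.le hr1
          _ = _ := Real.rpow_one _
      have h3 : (n : ℝ) ^ (1 - ι) ≤ n := by
        calc (n : ℝ) ^ (1 - ι) ≤ (n : ℝ) ^ (1 : ℝ) :=
              Real.rpow_le_rpow_of_exponent_le hn1 (by linarith)
          _ = n := Real.rpow_one _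
      rw [div_le_iff₀ hn0]
      refine (min_le_right _ _).trans ?_
      rw [div_le_iff₀' hCh]
      calc (1 : ℝ) ≤ Ch * ((n : ℝ) ^ (1 - ι) * (E / F n) ^ r) := hraten
        _ ≤ Ch * (n * (CF * E)) := by gcongr
        _ = Ch * (CF * E * n) := by ring
  calc _ ≤ K * E + 2 * Real.exp (-(n * x ^ r / (64 * (2 * A + 1)))) := hmain
    _ ≤ (K + CF) * E := by linarith
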